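/- In the problem of online packing into a dynamically growing square container, squares with positive side lengths $q_1, q_2, \dots$ arrive one after the other. A deterministic online algorithm places each arriving square irrevocably, knowing only the squares that have arrived so far: its position is a function of the list of side lengths received up to and including the current one. The squares are placed axis-parallel in the first quadrant of the plane, with pairwise disjoint interiors. The container is a square $[0,s]^2$ whose lower left corner is fixed at the origin and whose edge length $s$ is increased when necessary. After $n \ge 1$ squares have been placed, let $s_n$ be the smallest $s \ge 0$ such that $[0,s]^2$ contains all of them; the packing density at that time is $(q_1^2 + \dots + q_n^2)/s_n^2$. **Theorem.** There are sequences for which no deterministic online packing algorithm can maintain a density strictly greater than $3/7$: there is a finite sequence $(q_1,\dots,q_N)$ of positive side lengths such that, for every deterministic online algorithm, the packing density of the algorithm on this sequence is at most $3/7$ after some number $n \in \{1,\dots,N\}$ of squares. -/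

import Mathlib

namespace OnlinePacking

/-- The closed axis-parallel square with lower left corner `p` and side length `q`. -/
def square (p : ℝ × ℝ) (q : ℝ) : Set (ℝ × ℝ) :=
  Set.Icc p.1 (p.1 + q) ×ˢ Set.Icc p.2 (p.2 + q)

/-- The square container of edge length `s`: its lower left corner is fixed at the origin, and
it is enlarged by increasing `s`. -/
def container (s : ℝ) : Set (ℝ × ℝ) := square (0, 0) s

/-- A finite input sequence of squares, given by their positive side lengths in order of arrival. -/
def IsInput (σ : List ℝ) : Prop := ∀ q ∈ σ, 0 < q

/-- A deterministic online algorithm for packing squares into a growing square container.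
When the last square of the sequence `σ` arrives, only `σ` is known, and `place σ` is the
(irrevocable) lower left corner of the position given to that square. -/
structure OnlineAlgorithm where
  place : List ℝ → ℝ × ℝ
  /-- Every square is placed in the first quadrant, the union of all the containers. -/
  nonneg : ∀ σ : List ℝ, IsInput σ → ∀ k : Fin σ.length,
    0 ≤ (place (σ.take ((k : ℕ) + 1))).1 ∧ 0 ≤ (place (σ.take ((k : ℕ) + 1))).2
  /-- No two squares overlap. -/
  disjoint : ∀ σ : List ℝ, IsInput σ → ∀ i j : Fin σ.length, i ≠ j →
    Disjoint (interior (square (place (σ.take ((i : ℕ) + 1))) (σ.get i)))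
      (interior (square (place (σ.take ((j : ℕ) + 1))) (σ.get j)))

namespace OnlineAlgorithm

/-- The region occupied by the `k`-th square (counted from `0`) of the input `σ`. -/
def placed (alg : OnlineAlgorithm) (σ : List ℝ) (k : Fin σ.length) : Set (ℝ × ℝ) :=
  square (alg.place (σ.take ((k : ℕ) + 1))) (σ.get k)

/-- The edge length of the smallest container that holds all squares of `σ` as placed by `alg`. -/
noncomputable def side (alg : OnlineAlgorithm) (σ : List ℝ) : ℝ :=
  sInf {s : ℝ | 0 ≤ s ∧ ∀ k : Fin σ.length, alg.placed σ k ⊆ container s}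

/-- The packing density after the squares of `σ` have been placed: the total area of the squares
divided by the area of the smallest container. -/
noncomputable def density (alg : OnlineAlgorithm) (σ : List ℝ) : ℝ :=
  (σ.map (fun q => q ^ 2)).sum / alg.side σ ^ 2

/-- On the input `σ`, the algorithm maintains a density strictly greater than `c`: the density
exceeds `c` after each of the squares of `σ` has been placed. -/
def MaintainsDensityAbove (alg : OnlineAlgorithm) (c : ℝ) (σ : List ℝ) : Prop :=
  ∀ n : ℕ, 1 ≤ n → n ≤ σ.length → c < alg.density (σ.take n)

end OnlineAlgorithm

end OnlinePacking

namespace OnlinePacking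

/-! The input is fixed in advance. Density above 3/7 confines each square to a box of known size on
arrival (`add_lt_of_lt_density`), and disjoint squares are separated along an axis, so only linear
inequalities remain. These are refuted backwards: if 65 lies right of 59, there is no room left of
59 for either 33, so both lie below it, hence side by side; this forces both 16s below the first 33,
again side by side, and the first 8 below the first 16. The 6 and the second 8 then do not fit. -/

/-- Two squares with disjoint interiors are separated by an axis-parallel line. -/
theorem separated_of_disjoint_interior {p p' : ℝ × ℝ} {q q' : ℝ} (hq : 0 < q) (hq' : 0 < q')
    (h : Disjoint (interior (square p q)) (interior (square p' q'))) :
    (p.1 + q ≤ p'.1 ∨ p'.1 + q' ≤ p.1) ∨ (p.2 + q ≤ p'.2 ∨ p'.2 + q' ≤ p.2) := by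
  have key : ∀ a b : ℝ, min (a + q) (b + q') ≤ max a b → a + q ≤ b ∨ b + q' ≤ a := by
    intro a b hab
    rcases min_le_iff.1 hab with h1 | h1 <;> rcases le_max_iff.1 h1 with h2 | h2
    · linarith
    · exact Or.inl h2
    · exact Or.inr h2
    · linarith
  simp only [square, interior_prod_eq, interior_Icc, Set.disjoint_prod,
    Set.Ioo_disjoint_Ioo] at h
  exact h.imp (key _ _) (key _ _)

/-- If the density of the packing exceeds `c`, then every square lies inside the container of
side `r`, as soon as `c * r ^ 2` is at least the total area. -/
theorem OnlineAlgorithm.add_lt_of_lt_density (alg : OnlineAlgorithm) {σ : List ℝ}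
    (hσ : IsInput σ) {c r : ℝ} (hc : 0 < c) (hr : 0 ≤ r) (hd : c < alg.density σ)
    (hA : (σ.map (fun q => q ^ 2)).sum ≤ c * r ^ 2) (k : Fin σ.length) :
    (alg.place (σ.take ((k : ℕ) + 1))).1 + σ.get k < r ∧
      (alg.place (σ.take ((k : ℕ) + 1))).2 + σ.get k < r := by
  -- Since `x / 0 = 0`, side 0 would give density 0. This also excludes an empty set of containers,
  -- whose `sInf` is 0.
  have hs0 : alg.side σ ≠ 0 := by
    intro h0
    rw [density, h0] at hd
    norm_num at hd
    linarith
  have hne : {s : ℝ | 0 ≤ s ∧ ∀ k : Fin σ.length, alg.placed σ k ⊆ container s}.Nonempty := by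
    by_contra hempty
    rw [Set.not_nonempty_iff_eq_empty] at hempty
    exact hs0 (by rw [side, hempty, Real.sInf_empty])
  have hlt : alg.side σ < r := by
    have hpos : 0 < alg.side σ ^ 2 := by positivity
    rw [density, lt_div_iff₀ hpos] at hd
    exact lt_of_pow_lt_pow_left₀ 2 hr (lt_of_mul_lt_mul_left (hd.trans_le hA) hc.le)
  have hq : 0 < σ.get k := hσ _ (List.get_mem σ k)
  have hcorner : ∀ s ∈ {s : ℝ | 0 ≤ s ∧ ∀ k : Fin σ.length, alg.placed σ k ⊆ container s},
      (alg.place (σ.take ((k : ℕ) + 1))).1 + σ.get k ≤ s ∧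
        (alg.place (σ.take ((k : ℕ) + 1))).2 + σ.get k ≤ s := by
    rintro s ⟨-, hs⟩
    have hmem : ((alg.place (σ.take ((k : ℕ) + 1))).1 + σ.get k,
        (alg.place (σ.take ((k : ℕ) + 1))).2 + σ.get k) ∈ alg.placed σ k :=
      ⟨⟨by simpa using hq.le, le_rfl⟩, ⟨by simpa using hq.le, le_rfl⟩⟩
    have h2 := hs k hmem
    simp only [container, square, Set.mem_prod, Set.mem_Icc, zero_add] at h2
    exact ⟨h2.1.2, h2.2.2⟩
  exact ⟨(le_csInf hne fun s hs => (hcorner s hs).1).trans_lt hlt,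
    (le_csInf hne fun s hs => (hcorner s hs).2).trans_lt hlt⟩

/-- The side lengths of the squares that the adversary presents. -/
def sides : Fin 9 → ℝ := ![6, 8, 8, 16, 16, 33, 33, 59, 65]

/-- Containers of these sides hold the squares of `sides`, one after the other, whenever the
density stays above `3 / 7`. -/
def bounds : Fin 9 → ℝ := ![10, 16, 20, 32, 40, 65, 82, 122, 157]

/-- No packing in which the last square lies to the right of the second to last one respects
all the containers. -/
theorem not_packing_of_last_right (x y : Fin 9 → ℝ) (hx : ∀ i, 0 ≤ x i) (hy : ∀ i, 0 ≤ y i)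
    (hx' : ∀ i, x i + sides i < bounds i) (hy' : ∀ i, y i + sides i < bounds i)
    (hsep : ∀ i j, i ≠ j → (x i + sides i ≤ x j ∨ x j + sides j ≤ x i) ∨
      (y i + sides i ≤ y j ∨ y j + sides j ≤ y i))
    (h78 : x 7 + sides 7 ≤ x 8) : False := by
  have X0 : x 0 + 6 < 10 := hx' 0
  have Y0 : y 0 + 6 < 10 := hy' 0
  have X1 : x 1 + 8 < 16 := hx' 1
  have Y1 : y 1 + 8 < 16 := hy' 1
  have X2 : x 2 + 8 < 20 := hx' 2
  have Y2 : y 2 + 8 < 20 := hy' 2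
  have X3 : x 3 + 16 < 32 := hx' 3
  have Y3 : y 3 + 16 < 32 := hy' 3
  have X4 : x 4 + 16 < 40 := hx' 4
  have Y4 : y 4 + 16 < 40 := hy' 4
  have X5 : x 5 + 33 < 65 := hx' 5
  have Y5 : y 5 + 33 < 65 := hy' 5
  have X6 : x 6 + 33 < 82 := hx' 6
  have Y6 : y 6 + 33 < 82 := hy' 6
  have X7 : x 7 + 59 < 122 := hx' 7
  have Y7 : y 7 + 59 < 122 := hy' 7
  have X8 : x 8 + 65 < 157 := hx' 8
  have Y8 : y 8 + 65 < 157 := hy' 8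
  have X78 : x 7 + 59 ≤ x 8 := h78
  have sep57 : (x 5 + 33 ≤ x 7 ∨ x 7 + 59 ≤ x 5) ∨
      (y 5 + 33 ≤ y 7 ∨ y 7 + 59 ≤ y 5) := hsep 5 7 (by decide)
  -- `X8` and `X78` give x 7 < 33.
  have Y57 : y 5 + 33 ≤ y 7 := by
    rcases sep57 with (h | h) | (h | h) <;> linarith [hx 5, hy 5, hx 7, hy 7]
  have sep67 : (x 6 + 33 ≤ x 7 ∨ x 7 + 59 ≤ x 6) ∨
      (y 6 + 33 ≤ y 7 ∨ y 7 + 59 ≤ y 6) := hsep 6 7 (by decide)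
  have Y67 : y 6 + 33 ≤ y 7 := by
    rcases sep67 with (h | h) | (h | h) <;> linarith [hx 6, hy 6, hx 7, hy 7]
  have sep56 : (x 5 + 33 ≤ x 6 ∨ x 6 + 33 ≤ x 5) ∨
      (y 5 + 33 ≤ y 6 ∨ y 6 + 33 ≤ y 5) := hsep 5 6 (by decide)
  have X56 : x 5 + 33 ≤ x 6 := by
    rcases sep56 with (h | h) | (h | h) <;> linarith [hx 5, hy 5, hx 6, hy 6]
  have sep35 : (x 3 + 16 ≤ x 5 ∨ x 5 + 33 ≤ x 3) ∨
      (y 3 + 16 ≤ y 5 ∨ y 5 + 33 ≤ y 3) := hsep 3 5 (by decide)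
  -- `X56` and `X6` give x 5 < 16.
  have Y35 : y 3 + 16 ≤ y 5 := by
    rcases sep35 with (h | h) | (h | h) <;> linarith [hx 3, hy 3, hx 5, hy 5]
  have sep45 : (x 4 + 16 ≤ x 5 ∨ x 5 + 33 ≤ x 4) ∨
      (y 4 + 16 ≤ y 5 ∨ y 5 + 33 ≤ y 4) := hsep 4 5 (by decide)
  have Y45 : y 4 + 16 ≤ y 5 := by
    rcases sep45 with (h | h) | (h | h) <;> linarith [hx 4, hy 4, hx 5, hy 5]
  have sep34 : (x 3 + 16 ≤ x 4 ∨ x 4 + 16 ≤ x 3) ∨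
      (y 3 + 16 ≤ y 4 ∨ y 4 + 16 ≤ y 3) := hsep 3 4 (by decide)
  have X34 : x 3 + 16 ≤ x 4 := by
    rcases sep34 with (h | h) | (h | h) <;> linarith [hx 3, hy 3, hx 4, hy 4]
  have sep13 : (x 1 + 8 ≤ x 3 ∨ x 3 + 16 ≤ x 1) ∨
      (y 1 + 8 ≤ y 3 ∨ y 3 + 16 ≤ y 1) := hsep 1 3 (by decide)
  -- `X34` and `X4` give x 3 < 8.
  have Y13 : y 1 + 8 ≤ y 3 := by
    rcases sep13 with (h | h) | (h | h) <;> linarith [hx 1, hy 1, hx 3, hy 3]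
  have sep01 : (x 0 + 6 ≤ x 1 ∨ x 1 + 8 ≤ x 0) ∨
      (y 0 + 6 ≤ y 1 ∨ y 1 + 8 ≤ y 0) := hsep 0 1 (by decide)
  -- y 3 < 14, so y 1 < 6: the 6 does not fit below the first 8.
  have X01 : x 0 + 6 ≤ x 1 := by
    rcases sep01 with (h | h) | (h | h) <;> linarith [hx 0, hy 0, hx 1, hy 1]
  have sep12 : (x 1 + 8 ≤ x 2 ∨ x 2 + 8 ≤ x 1) ∨
      (y 1 + 8 ≤ y 2 ∨ y 2 + 8 ≤ y 1) := hsep 1 2 (by decide)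
  have Y12 : y 1 + 8 ≤ y 2 := by
    rcases sep12 with (h | h) | (h | h) <;> linarith [hx 0, hx 1, hy 1, hx 2, hy 2]
  have sep23 : (x 2 + 8 ≤ x 3 ∨ x 3 + 16 ≤ x 2) ∨
      (y 2 + 8 ≤ y 3 ∨ y 3 + 16 ≤ y 2) := hsep 2 3 (by decide)
  -- The second 8 has y 2 ≥ 8, but would need y 2 < 6 to lie below the first 16.
  rcases sep23 with (h | h) | (h | h) <;> linarith [hx 0, hx 1, hx 2, hy 1, hy 2, hx 3, hy 3]

/-- No packing of squares with side lengths `sides` respects all the containers. -/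
theorem not_packing (x y : Fin 9 → ℝ) (hx : ∀ i, 0 ≤ x i) (hy : ∀ i, 0 ≤ y i)
    (hx' : ∀ i, x i + sides i < bounds i) (hy' : ∀ i, y i + sides i < bounds i)
    (hsep : ∀ i j, i ≠ j → (x i + sides i ≤ x j ∨ x j + sides j ≤ x i) ∨
      (y i + sides i ≤ y j ∨ y j + sides j ≤ y i)) : False := by
  have X7 : x 7 + 59 < 122 := hx' 7
  have Y7 : y 7 + 59 < 122 := hy' 7
  rcases hsep 7 8 (by decide) with (h | h) | (h | h)
  · exact not_packing_of_last_right x y hx hy hx' hy' hsep h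
  · have h' : x 8 + 65 ≤ x 7 := h
    linarith [hx 8]
  -- Reflection in the diagonal.
  · exact not_packing_of_last_right y x hy hx hy' hx' (fun i j hij => (hsep i j hij).symm) h
  · have h' : y 8 + 65 ≤ y 7 := h
    linarith [hy 8]

/-- Each entry of `bounds` is the least integer satisfying this. -/
theorem sum_sq_take_le (i : Fin 9) :
    ((((List.ofFn sides).take ((i : ℕ) + 1)).map (fun q => q ^ 2)).sum ≤
      3 / 7 * bounds i ^ 2) := by
  fin_cases i <;> simp [sides, bounds, List.ofFn_succ] <;> norm_num

theorem sides_pos (i : Fin 9) : 0 < sides i := by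
  fin_cases i <;> simp [sides]

theorem bounds_nonneg (i : Fin 9) : 0 ≤ bounds i := by
  fin_cases i <;> simp [bounds]

end OnlinePacking

open OnlinePacking in
theorem mainTheorem3 :
    ∃ σ : List ℝ, OnlinePacking.IsInput σ ∧
      ∀ alg : OnlinePacking.OnlineAlgorithm, ¬ alg.MaintainsDensityAbove (3 / 7) σ := by
  have hinput : IsInput (List.ofFn sides) := by
    intro q hq
    obtain ⟨i, rfl⟩ := (List.mem_ofFn' _ _).1 hq
    exact sides_pos i
  refine ⟨List.ofFn sides, hinput, fun alg hd => ?_⟩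
  set σ := List.ofFn sides with hσ
  have hlen : σ.length = 9 := by simp [hσ]
  have hget : ∀ i : Fin 9, σ.get (i.cast hlen.symm) = sides i := fun i => List.get_ofFn sides _
  have hnonneg := fun i : Fin 9 => alg.nonneg σ hinput (i.cast hlen.symm)
  have hbound : ∀ i : Fin 9, (alg.place (σ.take ((i : ℕ) + 1))).1 + sides i < bounds i ∧
      (alg.place (σ.take ((i : ℕ) + 1))).2 + sides i < bounds i := by
    intro i
    have hi := i.isLt
    have hlt : (i : ℕ) < (σ.take ((i : ℕ) + 1)).length := by
      rw [List.length_take, hlen]; omega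
    have h := alg.add_lt_of_lt_density (fun q hq => hinput q (List.mem_of_mem_take hq))
      (by norm_num) (bounds_nonneg i) (hd ((i : ℕ) + 1) (by omega) (by omega))
      (sum_sq_take_le i) ⟨i, hlt⟩
    have hg : (σ.take ((i : ℕ) + 1)).get ⟨i, hlt⟩ = sides i := by
      rw [← hget i]; simp
    simpa only [hg, List.take_take, min_self] using h
  refine not_packing (fun i => (alg.place (σ.take ((i : ℕ) + 1))).1)
    (fun i => (alg.place (σ.take ((i : ℕ) + 1))).2) (fun i => (hnonneg i).1)
    (fun i => (hnonneg i).2) (fun i => (hbound i).1) (fun i => (hbound i).2) fun i j hij => ?_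
  have h := alg.disjoint σ hinput (i.cast hlen.symm) (j.cast hlen.symm)
    (fun h => hij (Fin.cast_injective _ h))
  rw [hget, hget] at h
  exact separated_of_disjoint_interior (sides_pos i) (sides_pos j) h
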